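/- Let $K$ be an infinite field of characteristic $p$ ($p=0$ or $p$ a prime), let $d \ge 2$ be an integer, and let $A = K[x,y,z]/(x^d, y^d, z^d)$ with its standard grading $A = \bigoplus_m [A]_m$. Say that $A$ has the strong Lefschetz property if there is a linear form $\ell \in [A]_1$ such that for all integers $m \ge 0$ and $k \ge 1$ the multiplication map $\times \ell^k : [A]_m \to [A]_{m+k}$ has maximal rank, i.e. rank equal to $\min(\dim_K [A]_m, \dim_K [A]_{m+k})$. Then $A$ has the strong Lefschetz property if and only if $p = 0$ or $p > 3(d-1)$. -/

import Mathlib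

open MvPolynomial

noncomputable section

namespace Lefschetz

variable {σ K : Type*} [Field K]

/-- The component `[A]_m` of the algebra `A = K[x_i : i ∈ σ] / I`, for a homogeneous ideal `I`:
the image in `A` of the space of homogeneous polynomials of degree `m`. -/
def component (I : Ideal (MvPolynomial σ K)) (m : ℕ) : Submodule K (MvPolynomial σ K ⧸ I) :=
  (homogeneousSubmodule σ K m).map (Ideal.Quotient.mkₐ K I).toLinearMap

theorem pow_mul_mem_component {I : Ideal (MvPolynomial σ K)} {l : MvPolynomial σ K ⧸ I}
    (hl : l ∈ component I 1) (m k : ℕ) {a : MvPolynomial σ K ⧸ I} (ha : a ∈ component I m) :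
    l ^ k * a ∈ component I (m + k) := by
  obtain ⟨f, hf, rfl⟩ := hl
  obtain ⟨g, hg, rfl⟩ := ha
  refine ⟨f ^ k * g, ?_, by simp⟩
  have h : (f ^ k * g).IsHomogeneous (1 * k + m) :=
    (IsHomogeneous.pow (show f.IsHomogeneous 1 from hf) k).mul hg
  rwa [one_mul, add_comm] at h

/-- The multiplication map `×l^k : [A]_m → [A]_{m+k}` by a power of a linear form `l ∈ [A]_1`. -/
def mulPow {I : Ideal (MvPolynomial σ K)} (l : component I 1) (m k : ℕ) :
    component I m →ₗ[K] component I (m + k) :=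
  (LinearMap.mulLeft K ((l : MvPolynomial σ K ⧸ I) ^ k)).restrict
    fun _ ha => pow_mul_mem_component l.2 m k ha

/-- A linear map has maximal rank if its rank is the minimum of the dimensions of its source
and target. -/
def HasMaximalRank {V W : Type*} [AddCommGroup V] [Module K V] [AddCommGroup W] [Module K W]
    (f : V →ₗ[K] W) : Prop :=
  Module.finrank K (LinearMap.range f) = min (Module.finrank K V) (Module.finrank K W)

/-- `l` is a strong Lefschetz element of `A = K[x_i : i ∈ σ] / I`. -/
def IsStrongLefschetzElement {I : Ideal (MvPolynomial σ K)} (l : component I 1) : Prop :=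
  ∀ m k : ℕ, 1 ≤ k → HasMaximalRank (mulPow l m k)

/-- The algebra `K[x_i : i ∈ σ] / I` (with `σ` finite and `I` homogeneous and artinian) has the
strong Lefschetz property. -/
def HasStrongLefschetzProperty (I : Ideal (MvPolynomial σ K)) : Prop :=
  ∃ l : component I 1, IsStrongLefschetzElement l

/-- The ideal `(x_i ^ (d i) : i ∈ σ)`, whose quotient is a monomial complete intersection. -/
def monomialIdeal (K : Type*) [Field K] {σ : Type*} (d : σ → ℕ) : Ideal (MvPolynomial σ K) :=
  Ideal.span (Set.range fun i => (X i : MvPolynomial σ K) ^ d i)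

end Lefschetz

end

noncomputable section

namespace Lefschetz

open Finset

/-! ### The sl₂-lowering operator and injectivity up to the middle degree. -/

section Lowering

variable {σ K : Type*} [Field K]

/-! Write `D = 3(d-1)` for the socle degree and `L` for the sum of the variables. If `1, …, D` are
invertible in `K`, the sl₂ argument works: a lowering operator descends to `A`, its commutator with
`L` is `D - 2m` in degree `m`, so `L ^ (D - 2m)` is injective on `[A]_m`
(`mem_of_sum_X_pow_mul_mem`), and symmetry of the Hilbert function yields the rest.

Conversely, let `0 < p ≤ D` and `q = p ^ n`. For every linear form `ℓ`, the power `ℓ ^ (q * t)`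
involves only `q`-th powers of monomials of degree `t`. With `t = 3e + 1`, pigeonhole gives each
such monomial a variable with exponent at least `q(e+1)`. For a suitable `q`, this makes `ℓ ^ (q *
t)` kill a nonzero monomial and miss another in the target degree
(`not_hasStrongLefschetzProperty_of_exponents`). -/

theorem mem_monomialIdeal_iff {d : σ → ℕ} {f : MvPolynomial σ K} :
    f ∈ monomialIdeal K d ↔ ∀ s, (∀ i, s i < d i) → coeff s f = 0 := by
  have h : monomialIdeal K d =
      Ideal.span ((fun s => monomial s (1 : K)) '' Set.range fun i => Finsupp.single i (d i)) := by
    rw [monomialIdeal, ← Set.range_comp]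
    congr 2
    funext i
    simp [X_pow_eq_monomial]
  rw [h, mem_ideal_span_monomial_image]
  simp only [Set.exists_range_iff, Finsupp.single_le_iff, mem_support_iff]
  refine forall_congr' fun s => ?_
  rw [← not_imp_not]
  push Not
  rfl

theorem monomial_notMem_monomialIdeal {d : σ → ℕ} {s : σ →₀ ℕ} (hs : ∀ i, s i < d i) :
    monomial s (1 : K) ∉ monomialIdeal K d := fun h => by
  classical simpa [coeff_monomial] using mem_monomialIdeal_iff.1 h s hs

variable [Fintype σ]

/-- The lowering operator `∑ᵢ (dᵢ - 1) ∂ᵢ - xᵢ ∂ᵢ²` of the `sl₂`-action on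
`K[x_i] / (x_i ^ dᵢ)` whose raising operator is the multiplication by `∑ᵢ xᵢ`. -/
def lowering (d : σ → ℕ) : MvPolynomial σ K →ₗ[K] MvPolynomial σ K :=
  ∑ i, (((d i : K) - 1) • (pderiv i).toLinearMap -
    LinearMap.mulLeft K (X i) ∘ₗ (pderiv i).toLinearMap ∘ₗ (pderiv i).toLinearMap)

theorem lowering_apply (d : σ → ℕ) (f : MvPolynomial σ K) :
    lowering d f = ∑ i, (C ((d i : K) - 1) * pderiv i f - X i * pderiv i (pderiv i f)) := by
  simp [lowering, LinearMap.sum_apply, smul_eq_C_mul]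

/-- The coefficient `dᵢ - 1` is chosen so that the operator kills `xᵢ ^ dᵢ`: the two contributions
`dᵢ(dᵢ - 1) xᵢ ^ (dᵢ - 1)` cancel. Hence the operator descends to `A`. -/
theorem lowering_mem_monomialIdeal {d : σ → ℕ} {f : MvPolynomial σ K}
    (hf : f ∈ monomialIdeal K d) : lowering d f ∈ monomialIdeal K d := by
  classical
  obtain ⟨c, rfl⟩ := Ideal.mem_span_range_iff_exists_fun.1 hf
  rw [map_sum]
  refine Ideal.sum_mem _ fun j _ => ?_
  rw [lowering_apply]
  refine Ideal.sum_mem _ fun i _ => ?_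
  have hX : (X j : MvPolynomial σ K) ^ d j ∈ monomialIdeal K d := Ideal.subset_span ⟨j, rfl⟩
  refine Ideal.mem_of_dvd _ ?_ hX
  by_cases hij : i = j
  · subst hij
    rcases d i with _ | _ | n
    · simp
    · simp
    · simp only [pderiv_mul, pderiv_pow, pderiv_X_self, map_add, map_sub, map_natCast, map_one]
      push_cast
      refine ⟨((n : MvPolynomial σ K) + 1) * pderiv i (c i) -
        2 * ((n : MvPolynomial σ K) + 2) * pderiv i (c i) -
        X i * pderiv i (pderiv i (c i)), ?_⟩
      have h2 : pderiv i ((n : MvPolynomial σ K) + 1 + 1) = 0 := by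
        rw [← map_natCast C n, ← C_1, ← C_add, ← C_add, pderiv_C]
      rw [h2, Derivation.map_one_eq_zero]
      ring
  · have h1 : pderiv i ((X j : MvPolynomial σ K) ^ d j) = 0 := by
      rw [pderiv_pow, pderiv_X_of_ne (Ne.symm hij), mul_zero]
    simp only [pderiv_mul, h1, mul_zero, add_zero]
    exact ⟨C ((d i : K) - 1) * pderiv i (c j) - X i * pderiv i (pderiv i (c j)), by ring⟩

theorem IsHomogeneous.lowering {d : σ → ℕ} {m : ℕ} {f : MvPolynomial σ K}
    (hf : f.IsHomogeneous (m + 1)) : (lowering d f).IsHomogeneous m := by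
  rw [lowering_apply]
  refine IsHomogeneous.sum _ _ _ fun i _ => ?_
  have h1 : (pderiv i f).IsHomogeneous m := hf.pderiv
  refine (by simpa using (isHomogeneous_C σ ((d i : K) - 1)).mul h1 :
    (C ((d i : K) - 1) * pderiv i f).IsHomogeneous m).sub ?_
  rcases m with _ | m
  · rw [← totalDegree_zero_iff_isHomogeneous, totalDegree_eq_zero_iff_eq_C] at h1
    rw [h1, pderiv_C, mul_zero]
    exact isHomogeneous_zero _ _ _
  · have := (isHomogeneous_X K i).mul (h1.pderiv (i := i))
    rwa [Nat.add_sub_cancel, add_comm] at this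

theorem lowering_eq_zero {d : σ → ℕ} {f : MvPolynomial σ K} (hf : f.IsHomogeneous 0) :
    lowering d f = 0 := by
  rw [← totalDegree_zero_iff_isHomogeneous, totalDegree_eq_zero_iff_eq_C] at hf
  rw [lowering_apply, hf]
  simp

/-- The commutation relation of sl₂; the weight `-2m` comes from Euler's identity. -/
theorem lowering_sum_X_mul {d : σ → ℕ} {m : ℕ} {f : MvPolynomial σ K} (hf : f.IsHomogeneous m) :
    lowering d ((∑ i, X i) * f) =
      (∑ i, X i) * lowering d f + C (∑ i, ((d i : K) - 1) - 2 * m) * f := by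
  classical
  have hsum (i : σ) : pderiv i (∑ j, X j : MvPolynomial σ K) = 1 := by
    simp [map_sum, pderiv_X, Pi.single_apply]
  have h (i : σ) : C ((d i : K) - 1) * pderiv i ((∑ j, X j) * f) -
        X i * pderiv i (pderiv i ((∑ j, X j) * f)) =
      (∑ j, X j) * (C ((d i : K) - 1) * pderiv i f - X i * pderiv i (pderiv i f)) +
        (C ((d i : K) - 1) * f - 2 * (X i * pderiv i f)) := by
    simp only [pderiv_mul, hsum, map_add, one_mul]
    ring
  rw [lowering_apply, lowering_apply, Finset.sum_congr rfl fun i _ => h i, sum_add_distrib,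
    ← mul_sum]
  congr 1
  rw [sum_sub_distrib, ← sum_mul, ← mul_sum, hf.sum_X_mul_pderiv]
  simp only [map_sub, map_sum, map_mul, map_natCast, nsmul_eq_mul, map_ofNat]
  ring

theorem isHomogeneous_sum_X : (∑ i, X i : MvPolynomial σ K).IsHomogeneous 1 :=
  IsHomogeneous.sum _ _ _ fun i _ => isHomogeneous_X K i

theorem IsHomogeneous.sum_X_pow_mul {m : ℕ} {f : MvPolynomial σ K} (hf : f.IsHomogeneous m)
    (j : ℕ) : ((∑ i, X i) ^ j * f).IsHomogeneous (j + m) := by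
  simpa using (isHomogeneous_sum_X.pow j).mul hf

theorem lowering_sum_X_pow_mul {d : σ → ℕ} {m : ℕ} {f : MvPolynomial σ K}
    (hf : f.IsHomogeneous m) (j : ℕ) :
    lowering d ((∑ i, X i) ^ (j + 1) * f) = (∑ i, X i) ^ (j + 1) * lowering d f +
      C ((j + 1) * (∑ i, ((d i : K) - 1) - 2 * m - j)) * ((∑ i, X i) ^ j * f) := by
  induction j with
  | zero => simpa using lowering_sum_X_mul hf
  | succ j ih =>
    rw [pow_succ', mul_assoc, lowering_sum_X_mul (IsHomogeneous.sum_X_pow_mul hf _), ih]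
    simp only [map_sub, map_mul, map_natCast, map_add, map_ofNat, map_one]
    push_cast
    ring

/-- The case of a primitive vector: lowering `L ^ (j+1) f = 0` in `A` gives a nonzero multiple of `L
^ j f`, so the power of `L` can be stripped one factor at a time. -/
theorem mem_of_lowering_mem {d : σ → ℕ} (hd : ∀ i, 1 ≤ d i)
    (hK : ∀ j : ℕ, 1 ≤ j → j ≤ ∑ i, (d i - 1) → (j : K) ≠ 0) {m N : ℕ}
    (hN : 2 * m + N = ∑ i, (d i - 1)) {f : MvPolynomial σ K} (hf : f.IsHomogeneous m)
    (hlow : lowering d f ∈ monomialIdeal K d) (h : (∑ i, X i) ^ N * f ∈ monomialIdeal K d) :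
    f ∈ monomialIdeal K d := by
  have hD : ∑ i, ((d i : K) - 1) = ((∑ i, (d i - 1) : ℕ) : K) := by
    rw [Nat.cast_sum]
    exact Finset.sum_congr rfl fun i _ => by rw [Nat.cast_sub (hd i), Nat.cast_one]
  have key (j : ℕ) (hj : j + 1 ≤ N) (hmem : (∑ i, X i) ^ (j + 1) * f ∈ monomialIdeal K d) :
      (∑ i, X i) ^ j * f ∈ monomialIdeal K d := by
    have h1 := lowering_mem_monomialIdeal hmem
    rw [lowering_sum_X_pow_mul hf, Ideal.add_mem_iff_right _ (Ideal.mul_mem_left _ _ hlow)] at h1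
    -- The scalar is `(j+1)(N-j)`, and both factors lie between 1 and the socle degree.
    have h2 : ((j : K) + 1) * (∑ i, ((d i : K) - 1) - 2 * m - j) ≠ 0 := by
      obtain ⟨t, rfl⟩ := Nat.exists_eq_add_of_le hj
      rw [hD, ← hN]
      refine mul_ne_zero (by exact_mod_cast hK (j + 1) (by omega) (by omega)) ?_
      convert hK (t + 1) (by omega) (by omega) using 1
      push_cast
      ring
    have h3 := Ideal.mul_mem_left _ (C ((j + 1) * (∑ i, ((d i : K) - 1) - 2 * m - j))⁻¹) h1
    rwa [← mul_assoc, ← C_mul, inv_mul_cancel₀ h2, C_1, one_mul] at h3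
  have hall : ∀ t ≤ N, (∑ i, X i) ^ (N - t) * f ∈ monomialIdeal K d := by
    intro t
    induction t with
    | zero => exact fun _ => h
    | succ t iht =>
      intro ht
      refine key _ (by omega) ?_
      rw [show N - (t + 1) + 1 = N - t by omega]
      exact iht (by omega)
  simpa using hall N le_rfl

theorem mem_of_sum_X_pow_mul_mem {d : σ → ℕ} (hd : ∀ i, 1 ≤ d i)
    (hK : ∀ j : ℕ, 1 ≤ j → j ≤ ∑ i, (d i - 1) → (j : K) ≠ 0) {m N : ℕ}
    (hN : 2 * m + N = ∑ i, (d i - 1)) {f : MvPolynomial σ K} (hf : f.IsHomogeneous m)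
    (h : (∑ i, X i) ^ N * f ∈ monomialIdeal K d) : f ∈ monomialIdeal K d := by
  induction m generalizing N f with
  | zero =>
    refine mem_of_lowering_mem hd hK hN hf ?_ h
    rw [lowering_eq_zero hf]
    exact Ideal.zero_mem _
  | succ m ih =>
    refine mem_of_lowering_mem hd hK hN hf
      (ih (N := N + 2) (by omega) (IsHomogeneous.lowering hf) ?_) h
    -- Lowering `L ^ (N+1) f = 0` shows that `L ^ (N+1)` kills the lowered `f`, so induction makes
    -- `f` primitive modulo the ideal.
    have h1 := lowering_mem_monomialIdeal (Ideal.mul_mem_left _ (∑ i, X i) h)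
    rw [← mul_assoc, ← pow_succ', lowering_sum_X_pow_mul hf,
      Ideal.add_mem_iff_left _ (Ideal.mul_mem_left _ _ h)] at h1
    rw [pow_succ', mul_assoc]
    exact Ideal.mul_mem_left _ _ h1

end Lowering

/-! ### Monomial bases and symmetry of the Hilbert function. -/

section Dimension

variable {σ K : Type*} [Field K] [Fintype σ]

/-- The exponents of the monomials of degree `m` that are not in `(x_i ^ (d i) : i ∈ σ)`. -/
abbrev BoxExponent (d : σ → ℕ) (m : ℕ) : Type _ :=
  {s : ∀ i, Fin (d i) // ∑ i, (s i : ℕ) = m}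

/-- An exponent in the box as a finitely supported function. -/
def BoxExponent.toFinsupp {d : σ → ℕ} {m : ℕ} (s : BoxExponent d m) : σ →₀ ℕ :=
  Finsupp.equivFunOnFinite.symm fun i => s.1 i

theorem BoxExponent.toFinsupp_injective {d : σ → ℕ} {m : ℕ} :
    Function.Injective (BoxExponent.toFinsupp : BoxExponent d m → σ →₀ ℕ) := fun _ _ h =>
  Subtype.ext <| funext fun i => Fin.ext <| DFunLike.congr_fun h i

theorem BoxExponent.degree_toFinsupp {d : σ → ℕ} {m : ℕ} (s : BoxExponent d m) :
    s.toFinsupp.degree = m := by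
  rw [Finsupp.degree_eq_sum]
  exact s.2

/-- The coefficients of a homogeneous polynomial at the exponents in the box. -/
def boxCoeff (K : Type*) [Field K] (d : σ → ℕ) (m : ℕ) :
    homogeneousSubmodule σ K m →ₗ[K] (BoxExponent d m → K) :=
  LinearMap.pi fun s => lcoeff K s.toFinsupp ∘ₗ (homogeneousSubmodule σ K m).subtype

theorem boxCoeff_apply (d : σ → ℕ) (m : ℕ) (f : homogeneousSubmodule σ K m)
    (s : BoxExponent d m) : boxCoeff K d m f s = coeff s.toFinsupp f.1 := rfl

theorem boxCoeff_surjective (d : σ → ℕ) (m : ℕ) : Function.Surjective (boxCoeff K d m) := by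
  classical
  intro c
  refine ⟨⟨∑ s, monomial s.toFinsupp (c s), Submodule.sum_mem _ fun s _ =>
    isHomogeneous_monomial _ s.degree_toFinsupp⟩, ?_⟩
  ext s
  simp [boxCoeff_apply, coeff_sum, coeff_monomial, BoxExponent.toFinsupp_injective.eq_iff]

theorem boxCoeff_eq_zero_iff {d : σ → ℕ} {m : ℕ} {f : homogeneousSubmodule σ K m} :
    boxCoeff K d m f = 0 ↔ f.1 ∈ monomialIdeal K d := by
  rw [mem_monomialIdeal_iff]
  constructor
  · intro h s hs
    by_contra hne
    have hdeg : ∑ i, s i = m := by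
      rw [← Finsupp.degree_eq_sum, Finsupp.degree_eq_weight_one]
      exact f.2 hne
    refine hne ?_
    have h1 := congrFun h ⟨fun i => ⟨s i, hs i⟩, hdeg⟩
    rwa [boxCoeff_apply, show BoxExponent.toFinsupp _ = s from Finsupp.ext fun i => rfl] at h1
  · intro h
    ext s
    exact h _ fun i => (s.1 i).2

/-- The component `[A]_m` of a monomial complete intersection has a basis indexed by the exponents
of degree `m` in the box. -/
def componentEquiv (K : Type*) [Field K] (d : σ → ℕ) (m : ℕ) :
    component (monomialIdeal K d) m ≃ₗ[K] (BoxExponent d m → K) :=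
  (((Ideal.Quotient.mkₐ K (monomialIdeal K d)).toLinearMap.submoduleMap
      (homogeneousSubmodule σ K m)).quotKerEquivOfSurjective
        (LinearMap.submoduleMap_surjective _ _)).symm ≪≫ₗ
    Submodule.quotEquivOfEq _ _ (by
      ext f
      rw [LinearMap.mem_ker, LinearMap.mem_ker, boxCoeff_eq_zero_iff, ← Subtype.coe_inj]
      exact Ideal.Quotient.eq_zero_iff_mem) ≪≫ₗ
    (boxCoeff K d m).quotKerEquivOfSurjective (boxCoeff_surjective d m)

instance (d : σ → ℕ) (m : ℕ) : FiniteDimensional K (component (monomialIdeal K d) m) :=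
  Module.Finite.equiv (componentEquiv K d m).symm

theorem finrank_component (d : σ → ℕ) (m : ℕ) :
    Module.finrank K (component (monomialIdeal K d) m) = Nat.card (BoxExponent d m) := by
  have := Fintype.ofFinite (BoxExponent d m)
  rw [(componentEquiv K d m).finrank_eq, Module.finrank_pi, Nat.card_eq_fintype_card]

theorem sum_rev_add_sum {d : σ → ℕ} (s : ∀ i, Fin (d i)) :
    ∑ i, ((s i).rev : ℕ) + ∑ i, (s i : ℕ) = ∑ i, (d i - 1) := by
  rw [← sum_add_distrib]
  refine sum_congr rfl fun i _ => ?_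
  rw [Fin.val_rev]
  omega

theorem finrank_component_eq_of_add_eq {d : σ → ℕ} {m n : ℕ} (h : m + n = ∑ i, (d i - 1)) :
    Module.finrank K (component (monomialIdeal K d) m) =
      Module.finrank K (component (monomialIdeal K d) n) := by
  rw [finrank_component, finrank_component]
  refine Nat.card_congr ⟨fun s => ⟨fun i => (s.1 i).rev, ?_⟩,
    fun s => ⟨fun i => (s.1 i).rev, ?_⟩, fun s => ?_, fun s => ?_⟩
  · have h1 := sum_rev_add_sum s.1
    have h2 := s.2
    dsimp only
    omega
  · have h1 := sum_rev_add_sum s.1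
    have h2 := s.2
    dsimp only
    omega
  · ext i
    simp
  · ext i
    simp

theorem finrank_component_eq_zero {d : σ → ℕ} {m : ℕ} (h : ∑ i, (d i - 1) < m) :
    Module.finrank K (component (monomialIdeal K d) m) = 0 := by
  rw [finrank_component, Finite.card_eq_zero_iff]
  refine ⟨fun s => ?_⟩
  have h1 := sum_rev_add_sum s.1
  have h2 := s.2
  omega

end Dimension

section MaximalRank

variable {K V W : Type*} [Field K] [AddCommGroup V] [Module K V] [AddCommGroup W] [Module K W]
  {f : V →ₗ[K] W}

theorem HasMaximalRank.of_injective [FiniteDimensional K W] (h : Function.Injective f) : HasMaximalRank f := by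
  rw [HasMaximalRank, LinearMap.finrank_range_of_inj h,
    min_eq_left (LinearMap.finrank_le_finrank_of_injective h)]

theorem HasMaximalRank.of_surjective [FiniteDimensional K V] (h : Function.Surjective f) : HasMaximalRank f := by
  rw [HasMaximalRank, LinearMap.range_eq_top.2 h, finrank_top,
    min_eq_right (LinearMap.finrank_le_finrank_of_surjective h)]

theorem HasMaximalRank.injective_or_surjective [FiniteDimensional K V]
    [FiniteDimensional K W] (h : HasMaximalRank f) :
    Function.Injective f ∨ Function.Surjective f := by
  rcases min_choice (Module.finrank K V) (Module.finrank K W) with h1 | h1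
  · left
    have h2 := f.finrank_range_add_finrank_ker
    rw [h, h1] at h2
    rw [← LinearMap.ker_eq_bot, ← Submodule.finrank_eq_zero (R := K)]
    omega
  · right
    rw [← LinearMap.range_eq_top]
    exact Submodule.eq_top_of_finrank_eq (h.trans h1)

end MaximalRank

/-! ### From injectivity below the middle to maximal rank everywhere. -/

section Sufficiency

variable {σ K : Type*} [Field K]

theorem mulPow_injective_iff {I : Ideal (MvPolynomial σ K)} {l : MvPolynomial σ K}
    (hl : l.IsHomogeneous 1) (m k : ℕ) :
    Function.Injective (mulPow (⟨Ideal.Quotient.mk I l, l, hl, rfl⟩ : component I 1) m k) ↔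
      ∀ f : MvPolynomial σ K, f.IsHomogeneous m → l ^ k * f ∈ I → f ∈ I := by
  rw [injective_iff_map_eq_zero]
  constructor
  · intro h f hf hmem
    have h1 := h ⟨Ideal.Quotient.mk I f, f, hf, rfl⟩ <| Subtype.ext <| by
      change Ideal.Quotient.mk I l ^ k * Ideal.Quotient.mk I f = 0
      rw [← map_pow, ← map_mul, Ideal.Quotient.eq_zero_iff_mem]
      exact hmem
    exact Ideal.Quotient.eq_zero_iff_mem.1 (congrArg Subtype.val h1)
  · rintro h ⟨_, f, hf, rfl⟩ h0
    have h1 : Ideal.Quotient.mk I l ^ k * Ideal.Quotient.mk I f = 0 := congrArg Subtype.val h0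
    rw [← map_pow, ← map_mul, Ideal.Quotient.eq_zero_iff_mem] at h1
    exact Subtype.ext (Ideal.Quotient.eq_zero_iff_mem.2 (h f hf h1))

theorem mulPow_surjective_iff {I : Ideal (MvPolynomial σ K)} {l : MvPolynomial σ K}
    (hl : l.IsHomogeneous 1) (m k : ℕ) :
    Function.Surjective (mulPow (⟨Ideal.Quotient.mk I l, l, hl, rfl⟩ : component I 1) m k) ↔
      ∀ g : MvPolynomial σ K, g.IsHomogeneous (m + k) →
        ∃ f : MvPolynomial σ K, f.IsHomogeneous m ∧ l ^ k * f - g ∈ I := by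
  constructor
  · intro h g hg
    obtain ⟨⟨_, f, hf, rfl⟩, h1⟩ := h ⟨Ideal.Quotient.mk I g, g, hg, rfl⟩
    have h2 : Ideal.Quotient.mk I l ^ k * Ideal.Quotient.mk I f = Ideal.Quotient.mk I g :=
      congrArg Subtype.val h1
    rw [← map_pow, ← map_mul, Ideal.Quotient.eq] at h2
    exact ⟨f, hf, h2⟩
  · rintro h ⟨_, g, hg, rfl⟩
    obtain ⟨f, hf, h1⟩ := h g hg
    refine ⟨⟨Ideal.Quotient.mk I f, f, hf, rfl⟩, Subtype.ext ?_⟩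
    change Ideal.Quotient.mk I l ^ k * Ideal.Quotient.mk I f = Ideal.Quotient.mk I g
    rw [← map_pow, ← map_mul, Ideal.Quotient.eq]
    exact h1

/-- The sum of the variables is a strong Lefschetz element of a monomial complete intersection
if the positive integers up to the socle degree are invertible in `K`. -/
theorem hasStrongLefschetzProperty_of_natCast_ne_zero [Fintype σ] {d : σ → ℕ}
    (hd : ∀ i, 1 ≤ d i) (hK : ∀ j : ℕ, 1 ≤ j → j ≤ ∑ i, (d i - 1) → (j : K) ≠ 0) :
    HasStrongLefschetzProperty (monomialIdeal K d) := by
  refine ⟨⟨Ideal.Quotient.mk _ (∑ i, X i), ∑ i, X i, isHomogeneous_sum_X, rfl⟩,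
    fun m k hk => ?_⟩
  have hinj (m k : ℕ) (h : 2 * m + k ≤ ∑ i, (d i - 1)) : Function.Injective
      (mulPow (⟨Ideal.Quotient.mk _ (∑ i, X i), ∑ i, X i, isHomogeneous_sum_X, rfl⟩ :
        component (monomialIdeal K d) 1) m k) := by
    rw [mulPow_injective_iff isHomogeneous_sum_X]
    intro f hf hmem
    obtain ⟨t, ht⟩ := Nat.exists_eq_add_of_le h
    refine mem_of_sum_X_pow_mul_mem hd hK (N := t + k) (by omega) hf ?_
    rw [pow_add, mul_assoc]
    exact Ideal.mul_mem_left _ _ hmem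
  rcases le_total (2 * m + k) (∑ i, (d i - 1)) with h | h
  · exact .of_injective (hinj m k h)
  refine .of_surjective ?_
  rcases le_or_gt (m + k) (∑ i, (d i - 1)) with h' | h'
  -- Degree `m'` is the mirror image of `m + k`. The bijection from `[A]_m'` to `[A]_(m+k)` factors
  -- through `[A]_m`, so its last factor is surjective.
  · obtain ⟨m', hm'⟩ := Nat.exists_eq_add_of_le h'
    obtain ⟨t, rfl⟩ := Nat.exists_eq_add_of_le (show m' ≤ m by omega)
    have hs := (LinearMap.injective_iff_surjective_of_finrank_eq_finrank
      (finrank_component_eq_of_add_eq (by omega))).1 (hinj m' (t + k) (by omega))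
    rw [mulPow_surjective_iff isHomogeneous_sum_X] at hs ⊢
    intro g hg
    obtain ⟨f, hf, hfg⟩ := hs g (by rwa [← add_assoc])
    refine ⟨(∑ i, X i) ^ t * f, by simpa [add_comm] using IsHomogeneous.sum_X_pow_mul hf t, ?_⟩
    rwa [← mul_assoc, ← pow_add, add_comm k]
  · have := Module.finrank_zero_iff.1 (finrank_component_eq_zero (K := K) h')
    exact fun y => ⟨0, Subsingleton.elim _ _⟩

end Sufficiency

/-! ### Frobenius obstructions in positive characteristic. -/

section Necessity

variable {σ K : Type*} [Field K] {p : ℕ} [ExpChar K p]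

/-- Raising to the `p ^ n`-th power is Frobenius on coefficients composed with `xᵢ ↦ xᵢ ^ (p ^ n)`.
-/
theorem exists_eq_smul_of_coeff_pow_ne_zero {f : MvPolynomial σ K} (hf : f.IsHomogeneous 1)
    {n t : ℕ} {s : σ →₀ ℕ} (h : coeff s (f ^ (p ^ n * t)) ≠ 0) :
    ∃ a : σ →₀ ℕ, a.degree = t ∧ s = p ^ n • a := by
  classical
  rw [mul_comm, pow_mul, ← map_iterateFrobenius_expand, coeff_map] at h
  have h1 : s ∈ (expand (p ^ n) (f ^ t)).support :=
    mem_support_iff.2 fun h0 => h (by rw [h0, map_zero])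
  obtain ⟨a, ha, rfl⟩ := Finset.mem_image.1 (support_expand_subset _ h1)
  refine ⟨a, ?_, rfl⟩
  rw [Finsupp.degree_eq_weight_one]
  exact (hf.pow t (mem_support_iff.1 ha)).trans (one_mul t)

theorem pow_mul_monomial_mem_monomialIdeal {f : MvPolynomial σ K} (hf : f.IsHomogeneous 1)
    {d : σ → ℕ} {n t : ℕ} {u : σ →₀ ℕ}
    (hu : ∀ a : σ →₀ ℕ, a.degree = t → ∃ i, d i ≤ p ^ n * a i + u i) :
    f ^ (p ^ n * t) * monomial u 1 ∈ monomialIdeal K d := by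
  rw [mem_monomialIdeal_iff]
  intro s hs
  rw [coeff_mul_monomial', mul_one]
  split_ifs with hus
  · by_contra hne
    obtain ⟨a, ha, hsa⟩ := exists_eq_smul_of_coeff_pow_ne_zero hf hne
    obtain ⟨i, hi⟩ := hu a ha
    have h1 : s i - u i = p ^ n * a i := DFunLike.congr_fun hsa i
    have h2 : u i ≤ s i := hus i
    have h3 := hs i
    omega
  · rfl

theorem exists_mul_le_of_pow_mul_sub_monomial_mem {f : MvPolynomial σ K} (hf : f.IsHomogeneous 1)
    {d : σ → ℕ} {n t : ℕ} {w : σ →₀ ℕ} (hw : ∀ i, w i < d i) {g : MvPolynomial σ K}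
    (h : f ^ (p ^ n * t) * g - monomial w 1 ∈ monomialIdeal K d) :
    ∃ a : σ →₀ ℕ, a.degree = t ∧ ∀ i, p ^ n * a i ≤ w i := by
  classical
  have h1 := mem_monomialIdeal_iff.1 h w hw
  rw [coeff_sub, coeff_monomial, if_pos rfl, sub_eq_zero, coeff_mul] at h1
  obtain ⟨x, hx, hne⟩ := Finset.exists_ne_zero_of_sum_ne_zero (h1.trans_ne one_ne_zero)
  obtain ⟨a, ha, hxa⟩ := exists_eq_smul_of_coeff_pow_ne_zero hf (left_ne_zero_of_mul hne)
  refine ⟨a, ha, fun i => ?_⟩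
  rw [← Finset.HasAntidiagonal.mem_antidiagonal.1 hx, hxa]
  simp

/-- In characteristic `p`, a power `l ^ (p ^ n * t)` of a linear form is supported on `p ^ n`-th
powers of monomials of degree `t`. If such monomials all annihilate the nonzero monomial `x ^ u`,
and none of them divides the nonzero monomial `x ^ w` of complementary degree, then the
multiplication by `l ^ (p ^ n * t)` is neither injective nor surjective. -/
theorem not_hasStrongLefschetzProperty_of_exponents [Fintype σ] {d : σ → ℕ} {n t : ℕ}
    (ht : 1 ≤ t) {u w : σ →₀ ℕ} (hud : ∀ i, u i < d i) (hwd : ∀ i, w i < d i)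
    (hdeg : w.degree = u.degree + p ^ n * t)
    (hu : ∀ a : σ →₀ ℕ, a.degree = t → ∃ i, d i ≤ p ^ n * a i + u i)
    (hw : ∀ a : σ →₀ ℕ, a.degree = t → ∃ i, w i < p ^ n * a i) :
    ¬ HasStrongLefschetzProperty (monomialIdeal K d) := by
  rintro ⟨⟨_, f, hf, rfl⟩, h⟩
  have hp : 0 < p := expChar_pos K p
  rcases (h u.degree (p ^ n * t) (Nat.mul_pos (pow_pos hp n) ht)).injective_or_surjective
    with h1 | h1
  · exact monomial_notMem_monomialIdeal hud <| (mulPow_injective_iff hf _ _).1 h1 _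
      (isHomogeneous_monomial _ rfl) (pow_mul_monomial_mem_monomialIdeal hf hu)
  · obtain ⟨g, -, hg⟩ := (mulPow_surjective_iff hf _ _).1 h1 (monomial w 1)
      (isHomogeneous_monomial _ hdeg)
    obtain ⟨a, ha, haw⟩ := exists_mul_le_of_pow_mul_sub_monomial_mem hf hwd hg
    obtain ⟨i, hi⟩ := hw a ha
    exact (haw i).not_gt hi

end Necessity

/-! ### Choice of the obstructing monomials in three variables. -/

section ThreeVariables

variable {K : Type*} [Field K] {p : ℕ} [ExpChar K p]

theorem degree_fin_three (a : Fin 3 →₀ ℕ) : a.degree = a 0 + a 1 + a 2 := by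
  rw [Finsupp.degree_eq_sum, Fin.sum_univ_three]

theorem exists_lt_of_degree {a : Fin 3 →₀ ℕ} {e : ℕ} (h : 3 * e < a.degree) : ∃ i, e < a i := by
  by_contra! hc
  have h0 := hc 0
  have h1 := hc 1
  have h2 := hc 2
  rw [degree_fin_three] at h
  omega

/-- Here `q(e+1) > d - 1`, so `ℓ ^ (q * t)` vanishes in `A`, although its degree does not exceed the
socle degree as `3r ≥ q`. -/
theorem not_hasStrongLefschetzProperty_of_carry {n e r : ℕ} (hr : r < p ^ n)
    (hr3 : p ^ n ≤ 3 * r) : ¬ HasStrongLefschetzProperty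
      (monomialIdeal K fun _ : Fin 3 => p ^ n * e + r + 1) := by
  have key (a : Fin 3 →₀ ℕ) (ha : a.degree = 3 * e + 1) :
      ∃ i, p ^ n * e + r < p ^ n * a i := by
    obtain ⟨i, hi⟩ := exists_lt_of_degree (a := a) (e := e) (by omega)
    have h1 : p ^ n * (e + 1) ≤ p ^ n * a i := Nat.mul_le_mul_left _ hi
    exact ⟨i, by rw [Nat.mul_add] at h1; omega⟩
  refine not_hasStrongLefschetzProperty_of_exponents (p := p) (n := n) (t := 3 * e + 1) (by omega)
    -- Any exponent of degree `3r - q` with entries at most `r` would do; truncated subtraction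
    -- covers both `2r ≤ q` and `2r > q`.
    (u := Finsupp.equivFunOnFinite.symm ![min r (3 * r - p ^ n), 2 * r - p ^ n, 0])
    (w := Finsupp.equivFunOnFinite.symm fun _ => p ^ n * e + r) ?_ ?_ ?_ ?_ key
  · intro i
    fin_cases i <;> simp
    all_goals omega
  · intro i
    simp
  · rw [degree_fin_three, degree_fin_three, Nat.mul_add, Nat.mul_left_comm]
    simp
    omega
  · intro a ha
    obtain ⟨i, hi⟩ := key a ha
    exact ⟨i, by omega⟩

/-- Now `d = q(e+1) + r + 1`, so `(xyz) ^ (r+1)` is killed. The entries of `w` stay below `q(e+1)`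
and have the required sum `3(r+1) + q(3e+1)`. -/
theorem not_hasStrongLefschetzProperty_of_no_carry {n e r : ℕ} (hr : 3 * r < p ^ n)
    (hr2 : 2 * r + 3 ≤ p ^ n) : ¬ HasStrongLefschetzProperty
      (monomialIdeal K fun _ : Fin 3 => p ^ n * (e + 1) + r + 1) := by
  have key (a : Fin 3 →₀ ℕ) (ha : a.degree = 3 * e + 1) :
      ∃ i, p ^ n * e + p ^ n ≤ p ^ n * a i := by
    obtain ⟨i, hi⟩ := exists_lt_of_degree (a := a) (e := e) (by omega)
    exact ⟨i, Nat.mul_le_mul_left _ hi⟩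
  refine not_hasStrongLefschetzProperty_of_exponents (p := p) (n := n) (t := 3 * e + 1) (by omega)
    (u := Finsupp.equivFunOnFinite.symm fun _ => r + 1)
    (w := Finsupp.equivFunOnFinite.symm
      ![p ^ n * e + (p ^ n - 1), p ^ n * e + (r + 2), p ^ n * e + (2 * r + 2)]) ?_ ?_ ?_ ?_ ?_
  · intro i
    simp only [Nat.mul_add, Finsupp.equivFunOnFinite_symm_apply_apply]
    omega
  · intro i
    fin_cases i <;> simp [Nat.mul_add] <;> omega
  · rw [degree_fin_three, degree_fin_three, Nat.mul_add, Nat.mul_left_comm]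
    simp
    omega
  · intro a ha
    obtain ⟨i, hi⟩ := key a ha
    refine ⟨i, ?_⟩
    simp only [Nat.mul_add, Finsupp.equivFunOnFinite_symm_apply_apply]
    omega
  · intro a ha
    obtain ⟨i, hi⟩ := key a ha
    refine ⟨i, lt_of_lt_of_le ?_ hi⟩
    fin_cases i <;> simp <;> omega

theorem not_hasStrongLefschetzProperty_of_le {p : ℕ} [CharP K p] (hp : p.Prime) {n : ℕ}
    (hn : n ≠ 0) (hpn : p ≤ 3 * n) :
    ¬ HasStrongLefschetzProperty (monomialIdeal K fun _ : Fin 3 => n + 1) := by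
  have : ExpChar K p := .prime hp
  rcases hp.eq_two_or_odd' with rfl | hodd
  -- For `p = 2`, taking `q` to be twice the 2-part of `n` leaves remainder `q/2`, which always
  -- falls in the carry case.
  · obtain ⟨k, _, ⟨e, rfl⟩, rfl⟩ := Nat.exists_eq_two_pow_mul_odd hn
    have hk : 0 < 2 ^ k := by positivity
    have h := not_hasStrongLefschetzProperty_of_carry (K := K) (p := 2) (n := k + 1) (e := e)
      (r := 2 ^ k) (by rw [pow_succ]; omega) (by rw [pow_succ]; omega)
    rwa [show 2 ^ (k + 1) * e + 2 ^ k = 2 ^ k * (2 * e + 1) by ring] at h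
  · have hdiv := Nat.div_add_mod n p
    have hlt := Nat.mod_lt n hp.pos
    rw [← hdiv]
    rcases le_or_gt p (3 * (n % p)) with h | h
    · simpa using not_hasStrongLefschetzProperty_of_carry (K := K) (p := p) (n := 1)
        (e := n / p) (r := n % p) (by simpa using hlt) (by simpa using h)
    · obtain ⟨e, he⟩ : ∃ e, n / p = e + 1 := Nat.exists_eq_succ_of_ne_zero fun h0 => by
        rw [h0, mul_zero] at hdiv
        omega
      -- From `3r < p` one gets `2r + 1 ≤ p`, with equality excluded as `p > 1`; oddness of `p`
      -- improves this to `2r + 3`.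
      have h3 : 2 * (n % p) + 3 ≤ p := by
        have := hp.two_le
        obtain ⟨b, rfl⟩ := hodd
        omega
      rw [he]
      simpa using not_hasStrongLefschetzProperty_of_no_carry (K := K) (p := p) (n := 1)
        (e := e) (r := n % p) (by simpa using h) (by simpa using h3)

end ThreeVariables

end Lefschetz

end

theorem theorem5p4 {K : Type*} [Field K] [Infinite K] (p : ℕ) [CharP K p] (d : ℕ) (hd : 2 ≤ d) :
    Lefschetz.HasStrongLefschetzProperty (Lefschetz.monomialIdeal K (fun _ : Fin 3 => d)) ↔
      p = 0 ∨ 3 * (d - 1) < p := by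
  constructor
  · intro h
    by_contra! hc
    refine Lefschetz.not_hasStrongLefschetzProperty_of_le (K := K) (n := d - 1)
      ((CharP.char_is_prime_or_zero K p).resolve_right hc.1) (by omega) hc.2 ?_
    rwa [Nat.sub_add_cancel (by omega)]
  · intro h
    refine Lefschetz.hasStrongLefschetzProperty_of_natCast_ne_zero (fun _ => by omega)
      fun j hj1 hj2 h0 => ?_
    rw [Finset.sum_const, Finset.card_univ, Fintype.card_fin, smul_eq_mul] at hj2
    have hdvd := (CharP.cast_eq_zero_iff K p j).1 h0
    rcases h with rfl | h
    · have := Nat.eq_zero_of_zero_dvd hdvd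
      omega
    · have := Nat.le_of_dvd hj1 hdvd
      omega
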